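/- Let $0\le x_A<x_B$ and $0\le y_A<y_C$. A seller offers two items to one buyer whose valuations $x$ and $y$ for items 1 and 2 are independent and uniformly distributed on $[x_A,x_B]$ and $[y_A,y_C]$ respectively; put $V=[x_A,x_B]\times[y_A,y_C]$. A mechanism consists of functions $q_1,q_2\colon V\to[0,1]$ (the probabilities with which the buyer receives the items) and $t\colon V\to\mathbb R$ (the payment). It is feasible in the unit-demand model if $q_1+q_2\le 1$ on $V$ and, writing $u(x,y)=xq_1(x,y)+yq_2(x,y)-t(x,y)$, it is individually rational, $u(x,y)\ge 0$ for all $(x,y)\in V$, and incentive compatible, $u(x,y)\ge xq_1(x',y')+yq_2(x',y')-t(x',y')$ for all $(x,y),(x',y')\in V$. Its revenue is $\mathbb E_{(x,y)}[t(x,y)]$, and its menu is the set $\{(q_1(x,y),q_2(x,y),t(x,y)) : (x,y)\in V\}$. Then there is a feasible mechanism that maximizes the revenue among all feasible mechanisms and whose menu consists of at most 5 items; more precisely, there are $\alpha,\beta\in[0,1]$ and $t_1,t_2,t_\alpha,t_\beta\in\mathbb R$ such that its menu is contained in $$\{(0,0,0),\ (1,0,t_1),\ (1-\alpha,\alpha,t_\alpha),\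 (0,1,t_2),\ (\beta,1-\beta,t_\beta)\}.$$ -/

import Mathlib

open MeasureTheory Set

/-- A direct mechanism for selling two items to one buyer whose type is the pair `v = (x, y)` of
valuations: at the report `v` the buyer receives item `i` with probability `qᵢ v` and pays `t v`.
Only the values on the buyer's type space matter. -/
structure Mechanism where
  q₁ : ℝ × ℝ → ℝ
  q₂ : ℝ × ℝ → ℝ
  t : ℝ × ℝ → ℝ

namespace Mechanism

/-- The utility of a buyer of type `v` who reports `w`. -/
def reportUtility (m : Mechanism) (v w : ℝ × ℝ) : ℝ :=
  v.1 * m.q₁ w + v.2 * m.q₂ w - m.t w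

/-- The utility of a buyer of type `v` who reports truthfully. -/
def utility (m : Mechanism) (v : ℝ × ℝ) : ℝ :=
  m.reportUtility v v

/-- The allocation consists of probabilities. -/
def IsAllocation (m : Mechanism) (V : Set (ℝ × ℝ)) : Prop :=
  ∀ v ∈ V, m.q₁ v ∈ Icc (0 : ℝ) 1 ∧ m.q₂ v ∈ Icc (0 : ℝ) 1

/-- Individual rationality on the type space `V`. -/
def IsIR (m : Mechanism) (V : Set (ℝ × ℝ)) : Prop :=
  ∀ v ∈ V, 0 ≤ m.utility v

/-- Incentive compatibility on the type space `V`. -/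
def IsIC (m : Mechanism) (V : Set (ℝ × ℝ)) : Prop :=
  ∀ v ∈ V, ∀ w ∈ V, m.reportUtility v w ≤ m.utility v

/-- The unit-demand constraint on the type space `V`. -/
def IsUnitDemand (m : Mechanism) (V : Set (ℝ × ℝ)) : Prop :=
  ∀ v ∈ V, m.q₁ v + m.q₂ v ≤ 1

/-- The mechanisms available to the seller in the unit-demand model. -/
structure IsFeasible (m : Mechanism) (V : Set (ℝ × ℝ)) : Prop where
  allocation : m.IsAllocation V
  unitDemand : m.IsUnitDemand V
  ir : m.IsIR V
  ic : m.IsIC V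

/-- The menu: the triples (probability of item 1, probability of item 2, payment) that are
assigned to some type in `V`. -/
def menu (m : Mechanism) (V : Set (ℝ × ℝ)) : Set (ℝ × ℝ × ℝ) :=
  (fun v => (m.q₁ v, m.q₂ v, m.t v)) '' V

/-- The seller's expected revenue when the buyer's type has law `μ`. -/
noncomputable def revenue (m : Mechanism) (μ : Measure (ℝ × ℝ)) : ℝ :=
  ∫ v, m.t v ∂μ

/-- `m` is revenue-optimal, for types in `V` with law `μ`, among all feasible unit-demand mechanisms.
The payment rule of `m` itself is required to be integrable; no regularity is asked of the
competitors `m'`. -/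
structure IsOptimal (m : Mechanism) (V : Set (ℝ × ℝ)) (μ : Measure (ℝ × ℝ)) : Prop where
  feasible : m.IsFeasible V
  integrable : Integrable m.t μ
  revenue_le : ∀ m' : Mechanism, m'.IsFeasible V → m'.revenue μ ≤ m.revenue μ

end Mechanism

/-- The rectangle of types `[xA, xB] × [yA, yC]`. -/
def typeSpace (xA xB yA yC : ℝ) : Set (ℝ × ℝ) :=
  Icc xA xB ×ˢ Icc yA yC

/-- The uniform distribution on `[a, b]`: Lebesgue measure conditioned on the interval. -/
noncomputable def uniformLaw (a b : ℝ) : Measure ℝ :=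
  ProbabilityTheory.cond volume (Icc a b)

/-- The joint law of independent valuations, uniform on `[xA, xB]` and on `[yA, yC]`. -/
noncomputable def typeLaw (xA xB yA yC : ℝ) : Measure (ℝ × ℝ) :=
  (uniformLaw xA xB).prod (uniformLaw yA yC)

/-! Incentive compatibility makes the allocation a subgradient of the utility `u`, so almost
everywhere `t = x u_x + y u_y - u`. Integration by parts turns revenue into edge integrals of `u`
minus three times its integral over the rectangle (`integral_payment_of_lipschitz`), and this splits
over the diagonals `x - y = d` (`integral_diagonalRevenue`).

Along a diagonal `u` grows at rate at most `q₁ + q₂ ≤ 1`. With its value at the exit point fixed,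
revenue falls as `u` rises elsewhere, so the best choice is the lower bound `max 0 (y + φ d)`, where
`φ` is the exit profile (`diagonalRevenue_le`). This `φ` is convex with slopes in `[0, 1]`, and the
revenue of diagonal `d` depends only on `φ d`.

It remains to improve `φ` on every diagonal at once (`exists_fourPiece_ge`). With the utility of the
lowest type normalised to zero, there are `l ≤ r` such that every type buys on the diagonals outside
`[l, r]`, where the revenue is linear in `φ d`: increasing near the two extreme diagonals,
decreasing closer to the middle. On `[l, r]` it is a concave quadratic with peak at a target that is
constant, then of slope one. Two lines, through the points of the graph over `l` and `r`, move `φ`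
towards the target on `[l, r]` and lie below `φ` on the outer side. A constant and a line of slope
one raise `φ` where that pays.

The maximum of these four lines, together with the null item, is a menu of five items. The
parameters range over a compact box on which revenue is continuous, so an optimum exists. -/

/-- `φ` is convex on `[a, b]` with slopes in `[0, 1]`: it has a subgradient in `[0, 1]` at every
point of the interval. -/
def HasUnitSubgradients (φ : ℝ → ℝ) (a b : ℝ) : Prop :=
  ∀ d ∈ Icc a b, ∃ σ ∈ Icc (0 : ℝ) 1, ∀ e ∈ Icc a b, φ d + σ * (e - d) ≤ φ e

/-! ### Convex functions on an interval, and lines moving them towards a target -/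

namespace HasUnitSubgradients

variable {φ : ℝ → ℝ} {a b : ℝ}

theorem monotone (h : HasUnitSubgradients φ a b) {d e : ℝ} (hd : d ∈ Icc a b) (he : e ∈ Icc a b)
    (hde : d ≤ e) : φ d ≤ φ e := by
  obtain ⟨σ, hσ, h'⟩ := h d hd
  have := h' e he
  nlinarith [hσ.1]

theorem sub_le (h : HasUnitSubgradients φ a b) {d e : ℝ} (hd : d ∈ Icc a b) (he : e ∈ Icc a b)
    (hde : d ≤ e) : φ e - φ d ≤ e - d := by
  obtain ⟨σ, hσ, h'⟩ := h e he
  have := h' d hd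
  nlinarith [hσ.2]

theorem continuousOn (h : HasUnitSubgradients φ a b) : ContinuousOn φ (Icc a b) := by
  have : LipschitzOnWith 1 φ (Icc a b) := by
    refine LipschitzOnWith.of_dist_le_mul fun x hx y hy => ?_
    rw [NNReal.coe_one, one_mul, Real.dist_eq, Real.dist_eq]
    rcases le_total x y with hxy | hxy
    · have h1 := h.monotone hx hy hxy
      have h2 := h.sub_le hx hy hxy
      rw [abs_of_nonpos (by linarith), abs_of_nonpos (by linarith)]
      linarith
    · have h1 := h.monotone hy hx hxy
      have h2 := h.sub_le hy hx hxy
      rw [abs_of_nonneg (by linarith), abs_of_nonneg (by linarith)]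
      linarith
  exact this.continuousOn

/-- The reflection `d ↦ φ (-d) + d`, which exchanges the two items. -/
theorem reflect (h : HasUnitSubgradients φ a b) :
    HasUnitSubgradients (fun d => φ (-d) + d) (-b) (-a) := by
  intro d hd
  obtain ⟨σ, hσ, h'⟩ := h (-d) ⟨by linarith [hd.2], by linarith [hd.1]⟩
  refine ⟨1 - σ, ⟨by linarith [hσ.2], by linarith [hσ.1]⟩, fun e he => ?_⟩
  have := h' (-e) ⟨by linarith [he.2], by linarith [he.1]⟩
  dsimp only
  linarith

/-- The chord over `[l, m]` lies above `φ` there and below `φ` elsewhere. -/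
theorem exists_chord (h : HasUnitSubgradients φ a b) {l m : ℝ} (hl : l ∈ Icc a b)
    (hm : m ∈ Icc a b) (hlm : l < m) :
    ∃ s ∈ Icc (0 : ℝ) 1, φ l + s * (m - l) = φ m ∧
      (∀ d ∈ Icc a b, d ≤ l ∨ m ≤ d → φ l + s * (d - l) ≤ φ d) ∧
      ∀ d ∈ Icc l m, φ d ≤ φ l + s * (d - l) := by
  have hml : 0 < m - l := by linarith
  obtain ⟨s, hs⟩ : ∃ s, s * (m - l) = φ m - φ l := ⟨(φ m - φ l) / (m - l), by field_simp⟩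
  have h1 := h.monotone hl hm hlm.le
  have h2 := h.sub_le hl hm hlm.le
  refine ⟨s, ⟨by by_contra hc; nlinarith, by by_contra hc; nlinarith⟩, by linarith, ?_, ?_⟩
  · rintro d hd (hdl | hmd)
    · obtain ⟨σ, -, h'⟩ := h l hl
      have h3 := h' m hm
      have h4 := h' d hd
      have : σ ≤ s := by by_contra hc; nlinarith
      nlinarith
    · obtain ⟨σ, -, h'⟩ := h m hm
      have h3 := h' l hl
      have h4 := h' d hd
      have : s ≤ σ := by by_contra hc; nlinarith
      nlinarith
  · intro d hd
    obtain ⟨σ, -, h'⟩ := h d ⟨hl.1.trans hd.1, hd.2.trans hm.2⟩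
    have h3 := h' l hl
    have h4 := h' m hm
    rcases le_total s σ with hc | hc
    · nlinarith [hd.2]
    · nlinarith [hd.1]

/-- Among the lines through `(l, φ l)` there is one that lies between `φ` and the level `c` on
`[l, e]`, and below `φ` outside of `[l, e]`. -/
theorem exists_line_left (h : HasUnitSubgradients φ a b) {l e : ℝ} (hl : l ∈ Icc a b)
    (he : e ∈ Icc a b) (hle : l ≤ e) (c : ℝ) :
    ∃ s ∈ Icc (0 : ℝ) 1, (∀ d ∈ Icc a b, d ≤ l ∨ e ≤ d → φ l + s * (d - l) ≤ φ d) ∧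
      ∀ d ∈ Icc l e, (φ d ≤ φ l + s * (d - l) ∧ φ l + s * (d - l) ≤ c) ∨
        (c ≤ φ l + s * (d - l) ∧ φ l + s * (d - l) ≤ φ d) := by
  rcases le_or_gt c (φ l) with hc | hc
  -- The level is already reached at `l`: a supporting line lies below `φ`, and its slope is
  -- nonnegative, so it stays above `c`.
  · obtain ⟨s, hs, h'⟩ := h l hl
    exact ⟨s, hs, fun d hd _ => h' d hd, fun d hd =>
      .inr ⟨by nlinarith [hs.1, hd.1], h' d ⟨hl.1.trans hd.1, hd.2.trans he.2⟩⟩⟩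
  -- Otherwise take the chord from `l` to the point where `φ` reaches `c`, or to `e` if it never
  -- does: up to `m` it lies between `φ` and `c`, beyond `m` between `c` and `φ`.
  obtain ⟨m, hm, hmc, hme⟩ : ∃ m ∈ Icc l e, φ m ≤ c ∧ (m = e ∨ φ m = c) := by
    rcases le_total (φ e) c with hec | hec
    · exact ⟨e, ⟨hle, le_rfl⟩, hec, .inl rfl⟩
    · obtain ⟨m, hm, hmc⟩ := intermediate_value_Icc hle
        (h.continuousOn.mono (Icc_subset_Icc hl.1 he.2)) ⟨hc.le, hec⟩
      exact ⟨m, hm, hmc.le, .inr hmc⟩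
  have hmab : m ∈ Icc a b := ⟨hl.1.trans hm.1, hm.2.trans he.2⟩
  rcases hm.1.eq_or_lt with rfl | hlm
  · obtain rfl : l = e := hme.resolve_right hc.ne
    obtain ⟨s, hs, h'⟩ := h l hl
    refine ⟨s, hs, fun d hd _ => h' d hd, fun d hd => .inl ?_⟩
    obtain rfl : d = l := le_antisymm hd.2 hd.1
    simpa using hc.le
  · obtain ⟨s, hs, hsm, hout, hin⟩ := h.exists_chord hl hmab hlm
    refine ⟨s, hs, fun d hd hde => hout d hd (hde.imp_right hm.2.trans), fun d hd => ?_⟩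
    rcases le_or_gt d m with hdm | hdm
    · exact .inl ⟨hin d ⟨hd.1, hdm⟩, by nlinarith [hs.1]⟩
    · have hmc' : φ m = c := hme.resolve_left fun hme => by linarith [hd.2]
      exact .inr ⟨by nlinarith [hs.1], hout d ⟨hl.1.trans hd.1, hd.2.trans he.2⟩ (.inr hdm.le)⟩

/-- The mirror image of `exists_line_left`. -/
theorem exists_line_right (h : HasUnitSubgradients φ a b) {e r : ℝ} (he : e ∈ Icc a b)
    (hr : r ∈ Icc a b) (her : e ≤ r) (c : ℝ) :
    ∃ s ∈ Icc (0 : ℝ) 1, (∀ d ∈ Icc a b, d ≤ e ∨ r ≤ d → φ r + s * (d - r) ≤ φ d) ∧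
      ∀ d ∈ Icc e r, (φ d ≤ φ r + s * (d - r) ∧ φ r + s * (d - r) ≤ c + d) ∨
        (c + d ≤ φ r + s * (d - r) ∧ φ r + s * (d - r) ≤ φ d) := by
  -- Under the reflection the target `c + d` becomes the level `c`, and a slope `s` becomes `1 - s`.
  obtain ⟨s, hs, hout, hin⟩ := h.reflect.exists_line_left (l := -r) (e := -e)
    ⟨by linarith [hr.2], by linarith [hr.1]⟩ ⟨by linarith [he.2], by linarith [he.1]⟩
    (by linarith) c
  simp only [neg_neg] at hout hin
  refine ⟨1 - s, ⟨by linarith [hs.2], by linarith [hs.1]⟩, fun d hd hde => ?_, fun d hd => ?_⟩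
  · have := hout (-d) ⟨by linarith [hd.2], by linarith [hd.1]⟩
      (by rcases hde with h | h
          · right; linarith
          · left; linarith)
    simp only [neg_neg] at this
    linarith
  · have := hin (-d) ⟨by linarith [hd.2], by linarith [hd.1]⟩
    simp only [neg_neg] at this
    rcases this with ⟨h1, h2⟩ | ⟨h1, h2⟩
    · left; constructor <;> linarith
    · right; constructor <;> linarith

/-- On `[l, r]`, `φ` can be replaced by the maximum of two lines that lies between `φ` and the
target, which is `c₁` to the left of `e` and `c₂ + d` to the right of `e`. -/
theorem exists_two_lines (h : HasUnitSubgradients φ a b) {l r : ℝ} (hl : l ∈ Icc a b)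
    (hr : r ∈ Icc a b) (hlr : l ≤ r) (e c₁ c₂ : ℝ) :
    ∃ s₁ ∈ Icc (0 : ℝ) 1, ∃ s₂ ∈ Icc (0 : ℝ) 1, s₁ ≤ s₂ ∧
      (∀ d ∈ Icc a l, φ l + s₁ * (d - l) ≤ φ d) ∧
      (∀ d ∈ Icc r b, φ r + s₂ * (d - r) ≤ φ d) ∧
      φ r + s₂ * (l - r) ≤ φ l ∧ φ l + s₁ * (r - l) ≤ φ r ∧
      ∀ d ∈ Icc l r, ∀ p, p = max (φ l + s₁ * (d - l)) (φ r + s₂ * (d - r)) →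
        ∀ c, c = (if d ≤ e then c₁ else c₂ + d) → (φ d ≤ p ∧ p ≤ c) ∨ (c ≤ p ∧ p ≤ φ d) := by
  rcases hlr.eq_or_lt with rfl | hlt
  · obtain ⟨s, hs, h'⟩ := h l hl
    refine ⟨s, hs, s, hs, le_rfl, fun d hd => h' d ⟨hd.1, hd.2.trans hl.2⟩,
      fun d hd => h' d ⟨hl.1.trans hd.1, hd.2⟩, by simp, by simp, fun d hd p hp c _ => ?_⟩
    obtain rfl : d = l := le_antisymm hd.2 hd.1
    have : p = φ d := by simp [hp]
    rcases le_total p c with hc | hc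
    · exact .inl ⟨this.ge, hc⟩
    · exact .inr ⟨hc, this.le⟩
  -- The breakpoint `e` of the target, clamped to `[l, r]`.
  have hf : max l (min r e) ∈ Icc l r := ⟨le_max_left _ _, max_le hlr (min_le_left _ _)⟩
  set f := max l (min r e) with hfdef
  have hfab : f ∈ Icc a b := ⟨hl.1.trans hf.1, hf.2.trans hr.2⟩
  obtain ⟨s₁, hs₁, hout₁, hin₁⟩ := h.exists_line_left hl hfab hf.1 c₁
  obtain ⟨s₂, hs₂, hout₂, hin₂⟩ := h.exists_line_right hfab hr hf.2 c₂
  have hr₁ := hout₁ r hr (.inr hf.2)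
  have hl₂ := hout₂ l hl (.inl hf.1)
  refine ⟨s₁, hs₁, s₂, hs₂, by by_contra hc; nlinarith,
    fun d hd => hout₁ d ⟨hd.1, hd.2.trans hl.2⟩ (.inl hd.2),
    fun d hd => hout₂ d ⟨hr.1.trans hd.1, hd.2⟩ (.inr hd.1), hl₂, hr₁, ?_⟩
  rintro d hd p rfl c rfl
  have hdab : d ∈ Icc a b := ⟨hl.1.trans hd.1, hd.2.trans hr.2⟩
  by_cases hdl : d = l
  · subst hdl
    have : max (φ d + s₁ * (d - d)) (φ r + s₂ * (d - r)) = φ d := by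
      rw [max_eq_left] <;> simp [hl₂]
    rw [this]
    rcases le_total (φ d) (if d ≤ e then c₁ else c₂ + d) with hc | hc
    · exact .inl ⟨le_rfl, hc⟩
    · exact .inr ⟨hc, le_rfl⟩
  -- On either side of `f`, the line from the far end is below `φ`. Taking the maximum with it
  -- therefore cannot leave the range between `φ` and the target.
  by_cases hde : d ≤ e
  · have hdf : d ≤ f := (le_min hd.2 hde).trans (le_max_right _ _)
    rw [if_pos hde]
    have h2 := hout₂ d hdab (.inl hdf)
    rcases hin₁ d ⟨hd.1, hdf⟩ with ⟨h3, h4⟩ | ⟨h3, h4⟩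
    · rw [max_eq_left (h2.trans h3)]
      exact .inl ⟨h3, h4⟩
    · exact .inr ⟨h3.trans (le_max_left _ _), max_le h4 h2⟩
  · have hdf : f ≤ d := max_le hd.1 ((min_le_right _ _).trans (not_le.1 hde).le)
    rw [if_neg hde]
    have h2 := hout₁ d hdab (.inr hdf)
    rcases hin₂ d ⟨hdf, hd.2⟩ with ⟨h3, h4⟩ | ⟨h3, h4⟩
    · rw [max_eq_right (h2.trans h3)]
      exact .inl ⟨h3, h4⟩
    · exact .inr ⟨h3.trans (le_max_right _ _), max_le h2 h4⟩

end HasUnitSubgradients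

/-! ### Revenue along a diagonal -/

/-- The height at which the diagonal `x - y = d` leaves the rectangle of types. -/
noncomputable def exitY (xB yC d : ℝ) : ℝ := min yC (xB - d)

/-- The height at which the diagonal `x - y = d` enters the rectangle of types. -/
noncomputable def entryY (xA yA d : ℝ) : ℝ := max yA (xA - d)

/-- The contribution of the diagonal `x - y = d` to the revenue of a mechanism whose utility
function is `U`. -/
noncomputable def diagonalRevenue (xA xB yA yC : ℝ) (U : ℝ × ℝ → ℝ) (d : ℝ) : ℝ :=
  (if d ≤ xB - yC then yC else xB) * U (d + exitY xB yC d, exitY xB yC d)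
    - (if d ≤ xA - yA then xA else yA) * U (d + entryY xA yA d, entryY xA yA d)
    - 3 * ∫ y in entryY xA yA d..exitY xB yC d, U (d + y, y)

/-- The utility function of a menu in which every item but the null item sells some good for sure;
`φ (x - y)` is the utility of type `(x, y)` from buying, minus `y`. -/
noncomputable def saleUtility (φ : ℝ → ℝ) (v : ℝ × ℝ) : ℝ := max 0 (v.2 + φ (v.1 - v.2))

theorem entryY_le_exitY {xA xB yA yC d : ℝ} (hx : xA < xB) (hy : yA < yC)
    (hd : d ∈ Icc (xA - yC) (xB - yA)) : entryY xA yA d ≤ exitY xB yC d :=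
  max_le (le_min hy.le (by linarith [hd.2])) (le_min (by linarith [hd.1]) (by linarith))

theorem integral_add_const (a b p : ℝ) : ∫ y in a..b, (y + p) = ((b + p) ^ 2 - (a + p) ^ 2) / 2 := by
  rw [intervalIntegral.integral_comp_add_right (fun y => y), integral_id]

theorem diagonalRevenue_saleUtility (xA xB yA yC : ℝ) (φ : ℝ → ℝ) (d : ℝ) :
    diagonalRevenue xA xB yA yC (saleUtility φ) d =
      (if d ≤ xB - yC then yC else xB) * max 0 (exitY xB yC d + φ d)
        - (if d ≤ xA - yA then xA else yA) * max 0 (entryY xA yA d + φ d)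
        - 3 * ∫ y in entryY xA yA d..exitY xB yC d, max 0 (y + φ d) := by
  simp only [diagonalRevenue, saleUtility, add_sub_cancel_right]

/-- The revenue from a diagonal on which every type buys. -/
theorem diagonalRevenue_of_entry_nonneg {xA xB yA yC : ℝ} {φ : ℝ → ℝ} {d : ℝ}
    (hd : entryY xA yA d ≤ exitY xB yC d) (h : 0 ≤ entryY xA yA d + φ d) :
    diagonalRevenue xA xB yA yC (saleUtility φ) d =
      (if d ≤ xB - yC then yC else xB) * (exitY xB yC d + φ d)
        - (if d ≤ xA - yA then xA else yA) * (entryY xA yA d + φ d)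
        - 3 / 2 * ((exitY xB yC d + φ d) ^ 2 - (entryY xA yA d + φ d) ^ 2) := by
  rw [diagonalRevenue_saleUtility, max_eq_right h, max_eq_right (by linarith)]
  have : ∫ y in entryY xA yA d..exitY xB yC d, max 0 (y + φ d) =
      ∫ y in entryY xA yA d..exitY xB yC d, (y + φ d) := by
    refine intervalIntegral.integral_congr fun y hy => ?_
    rw [uIcc_of_le hd] at hy
    exact max_eq_right (by linarith [hy.1])
  rw [this, integral_add_const]
  ring

/-- The revenue from a diagonal on which the lowest type does not buy, but the highest one does. -/
theorem diagonalRevenue_of_entry_nonpos {xA xB yA yC : ℝ} {φ : ℝ → ℝ} {d : ℝ}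
    (h : entryY xA yA d + φ d ≤ 0) (h' : 0 ≤ exitY xB yC d + φ d) :
    diagonalRevenue xA xB yA yC (saleUtility φ) d =
      (if d ≤ xB - yC then yC else xB) * (exitY xB yC d + φ d)
        - 3 / 2 * (exitY xB yC d + φ d) ^ 2 := by
  rw [diagonalRevenue_saleUtility, max_eq_left h, max_eq_right h']
  have hc : Continuous fun y : ℝ => max 0 (y + φ d) := by fun_prop
  rw [← intervalIntegral.integral_add_adjacent_intervals (b := -φ d)
    (hc.intervalIntegrable _ _) (hc.intervalIntegrable _ _)]
  have h1 : ∫ y in entryY xA yA d..-φ d, max 0 (y + φ d) = 0 := by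
    refine (intervalIntegral.integral_congr (g := fun _ => (0 : ℝ)) fun y hy => ?_).trans
      intervalIntegral.integral_zero
    rw [uIcc_of_le (by linarith)] at hy
    exact max_eq_left (show y + φ d ≤ 0 by linarith [hy.2])
  have h2 : ∫ y in -φ d..exitY xB yC d, max 0 (y + φ d) =
      ∫ y in -φ d..exitY xB yC d, (y + φ d) := by
    refine intervalIntegral.integral_congr fun y hy => ?_
    rw [uIcc_of_le (by linarith)] at hy
    exact max_eq_right (by linarith [hy.1])
  rw [h1, h2, integral_add_const]
  ring

/-! ### Reduction to four-piece functions -/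

/-- The maximum of a constant, two lines and a line of slope one. -/
noncomputable def fourPiece (c : (ℝ × ℝ) × (ℝ × ℝ) × (ℝ × ℝ)) (d : ℝ) : ℝ :=
  max (max c.1.1 (c.2.1.1 * d + c.2.1.2)) (max (c.2.2.1 * d + c.2.2.2) (d + c.1.2))

/-- The parameters of four-piece functions with slopes in `[0, 1]` and other coefficients in
`[-M, M]`. -/
def fourPieceBox (M : ℝ) : Set ((ℝ × ℝ) × (ℝ × ℝ) × (ℝ × ℝ)) :=
  (Icc (-M) M ×ˢ Icc (-M) M) ×ˢ (Icc 0 1 ×ˢ Icc (-M) M) ×ˢ (Icc 0 1 ×ˢ Icc (-M) M)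

section Reduction

variable {xA xB yA yC : ℝ} {φ ψ : ℝ → ℝ} {d : ℝ}

/-- With `s` the utility at the exit and `w` the weight there (`yC` or `xB`), the revenue is the
concave quadratic `w * s - 3 / 2 * s ^ 2`. Its peak `s = w / 3` is the target `c` in `hb`, so moving
`φ d` towards `c` without overshooting cannot hurt. -/
theorem diagonalRevenue_le_of_between (h : entryY xA yA d + φ d ≤ 0)
    (hψ : entryY xA yA d + ψ d ≤ 0) (h' : 0 ≤ exitY xB yC d + φ d) (hψ' : 0 ≤ exitY xB yC d + ψ d)
    (hb : ∀ c, c = (if d ≤ xB - yC then -(2 / 3) * yC else -(2 / 3) * xB + d) →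
      (φ d ≤ ψ d ∧ ψ d ≤ c) ∨ (c ≤ ψ d ∧ ψ d ≤ φ d)) :
    diagonalRevenue xA xB yA yC (saleUtility φ) d ≤
      diagonalRevenue xA xB yA yC (saleUtility ψ) d := by
  rw [diagonalRevenue_of_entry_nonpos h h', diagonalRevenue_of_entry_nonpos hψ hψ']
  replace hb := hb _ rfl
  by_cases hd : d ≤ xB - yC
  · have he : exitY xB yC d = yC := min_eq_left (by linarith)
    simp only [he, if_pos hd] at *
    rcases hb with ⟨h1, h2⟩ | ⟨h1, h2⟩ <;> nlinarith
  · have he : exitY xB yC d = xB - d := min_eq_right (by linarith)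
    simp only [he, if_neg hd] at *
    rcases hb with ⟨h1, h2⟩ | ⟨h1, h2⟩ <;> nlinarith

/-- When every type on the diagonal buys, the squares of `φ d` cancel and the revenue is linear in
`φ d`. Its slope is `2 * (xA - yC) - 3 * d` if the diagonal exits through the top edge, and `-2 *
(xB - xA)` if it exits on the right. -/
theorem diagonalRevenue_le_of_entry_left (hx : xA < xB) (hd : d ∈ Icc (xA - yC) (xA - yA))
    (h : 0 ≤ xA - d + φ d) (hψ : 0 ≤ xA - d + ψ d)
    (h1 : d ≤ xB - yC → d ≤ 2 / 3 * (xA - yC) → φ d ≤ ψ d)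
    (h2 : xB - yC < d ∨ 2 / 3 * (xA - yC) < d → ψ d ≤ φ d) :
    diagonalRevenue xA xB yA yC (saleUtility φ) d ≤
      diagonalRevenue xA xB yA yC (saleUtility ψ) d := by
  have he : entryY xA yA d = xA - d := max_eq_right (by linarith [hd.2])
  have hle : entryY xA yA d ≤ exitY xB yC d := by
    rw [he]; exact le_min (by linarith [hd.1]) (by linarith)
  rw [diagonalRevenue_of_entry_nonneg hle (by rwa [he]),
    diagonalRevenue_of_entry_nonneg hle (by rwa [he]), he, if_pos hd.2]
  by_cases hd0 : d ≤ xB - yC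
  · have hex : exitY xB yC d = yC := min_eq_left (by linarith)
    rw [hex, if_pos hd0]
    rcases le_or_gt d (2 / 3 * (xA - yC)) with hz | hz
    · nlinarith [h1 hd0 hz]
    · nlinarith [h2 (.inr hz)]
  · have hex : exitY xB yC d = xB - d := min_eq_right (by linarith)
    rw [hex, if_neg hd0]
    nlinarith [h2 (.inl (not_le.1 hd0))]

/-- Again linear in `φ d`, with slope `-2 * (yC - yA)` for an exit through the top and `3 * d - 2 *
(xB - yA)` for an exit on the right. -/
theorem diagonalRevenue_le_of_entry_bottom (hy : yA < yC) (hd : d ∈ Ioc (xA - yA) (xB - yA))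
    (h : 0 ≤ yA + φ d) (hψ : 0 ≤ yA + ψ d)
    (h1 : xB - yC < d → 2 / 3 * (xB - yA) ≤ d → φ d ≤ ψ d)
    (h2 : d ≤ xB - yC ∨ d < 2 / 3 * (xB - yA) → ψ d ≤ φ d) :
    diagonalRevenue xA xB yA yC (saleUtility φ) d ≤
      diagonalRevenue xA xB yA yC (saleUtility ψ) d := by
  have he : entryY xA yA d = yA := max_eq_left (by linarith [hd.1])
  have hle : entryY xA yA d ≤ exitY xB yC d := by
    rw [he]; exact le_min hy.le (by linarith [hd.2])
  rw [diagonalRevenue_of_entry_nonneg hle (by rwa [he]),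
    diagonalRevenue_of_entry_nonneg hle (by rwa [he]), he, if_neg (not_le.2 hd.1)]
  by_cases hd0 : d ≤ xB - yC
  · have hex : exitY xB yC d = yC := min_eq_left (by linarith)
    rw [hex, if_pos hd0]
    nlinarith [h2 (.inl hd0)]
  · have hex : exitY xB yC d = xB - d := min_eq_right (by linarith)
    rw [hex, if_neg hd0]
    rcases le_or_gt (2 / 3 * (xB - yA)) d with hz | hz
    · nlinarith [h1 (not_le.1 hd0) hz]
    · nlinarith [h2 (.inr hz)]

set_option maxHeartbeats 1000000 in
/-- If `φ` is convex with slopes in `[0, 1]`, leaves nonnegative utility to the highest type of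
every diagonal, and no positive utility to the lowest type of all, then a four-piece function does
at least as well as `φ` on every diagonal. -/
theorem exists_fourPiece_ge (hxA : 0 ≤ xA) (hx : xA < xB) (hyA : 0 ≤ yA) (hy : yA < yC)
    (h : HasUnitSubgradients φ (xA - yC) (xB - yA))
    (hexit : ∀ d ∈ Icc (xA - yC) (xB - yA), 0 ≤ exitY xB yC d + φ d)
    (hlow : yA + φ (xA - yA) ≤ 0) :
    ∃ c ∈ fourPieceBox (3 * (xB + yC)), ∀ d ∈ Icc (xA - yC) (xB - yA),
      diagonalRevenue xA xB yA yC (saleUtility φ) d ≤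
        diagonalRevenue xA xB yA yC (saleUtility (fourPiece c)) d := by
  have hab : xA - yC ≤ xB - yA := by linarith
  have ha : xA - yC ∈ Icc (xA - yC) (xB - yA) := ⟨le_rfl, hab⟩
  have hb : xB - yA ∈ Icc (xA - yC) (xB - yA) := ⟨hab, le_rfl⟩
  have h1 : xA - yA ∈ Icc (xA - yC) (xB - yA) := ⟨by linarith, by linarith⟩
  have hφa : 0 ≤ yC + φ (xA - yC) := by
    have := hexit _ ha
    rwa [exitY, min_eq_left (by linarith)] at this
  have hφb : 0 ≤ yA + φ (xB - yA) := by
    have := hexit _ hb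
    rwa [exitY, min_eq_right (by linarith), sub_sub_cancel] at this
  have hbound : ∀ d ∈ Icc (xA - yC) (xB - yA), |φ d| ≤ xB + yC := by
    intro d hd
    have h2 := hexit d hd
    have h3 : exitY xB yC d ≤ yC := min_le_left _ _
    rw [abs_le]
    refine ⟨by linarith, ?_⟩
    rcases le_total d (xA - yA) with hc | hc
    · linarith [h.monotone hd h1 hc]
    · linarith [h.sub_le h1 hd hc, hd.2]
  have hdbound : ∀ d ∈ Icc (xA - yC) (xB - yA), |d| ≤ xB + yC := fun d hd =>
    abs_le.2 ⟨by linarith [hd.1], by linarith [hd.2]⟩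
  -- On diagonal `l` the entry type on the left edge is just indifferent to buying; `r` is the
  -- analogue on the bottom edge.
  obtain ⟨l, hl, hφl⟩ : ∃ l ∈ Icc (xA - yC) (xA - yA), φ l - l = -xA := by
    refine intermediate_value_Icc' (by linarith) ((h.continuousOn.mono
      (Icc_subset_Icc le_rfl (by linarith))).sub continuousOn_id) ⟨?_, ?_⟩ <;>
        simp only [Pi.sub_apply, id] <;> linarith
  obtain ⟨r, hr, hφr⟩ : ∃ r ∈ Icc (xA - yA) (xB - yA), φ r = -yA := by
    refine intermediate_value_Icc (by linarith) (h.continuousOn.mono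
      (Icc_subset_Icc (by linarith) le_rfl)) ⟨?_, ?_⟩ <;> linarith
  have hlab : l ∈ Icc (xA - yC) (xB - yA) := ⟨hl.1, by linarith [hl.2]⟩
  have hrab : r ∈ Icc (xA - yC) (xB - yA) := ⟨by linarith [hr.1], hr.2⟩
  have hlr : l ≤ r := hl.2.trans hr.1
  obtain ⟨s₁, hs₁, s₂, hs₂, hs, hleft, hright, hl₂, hr₁, hmid⟩ :=
    h.exists_two_lines hlab hrab hlr (xB - yC) (-(2 / 3) * yC) (-(2 / 3) * xB)
  -- To the left of `l`, larger `φ` is better exactly up to `p`; to the right of `r`, exactly from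
  -- `q` on. Both are clamped to the range of diagonals.
  set p := max (xA - yC) (min l (min (xB - yC) (2 / 3 * (xA - yC)))) with hp
  have hpl : p ≤ l := max_le hl.1 (min_le_left _ _)
  have hpab : p ∈ Icc (xA - yC) (xB - yA) := ⟨le_max_left _ _, hpl.trans hlab.2⟩
  set q := min (xB - yA) (max r (max (xB - yC) (2 / 3 * (xB - yA)))) with hq
  have hrq : r ≤ q := le_min hr.2 (le_max_left _ _)
  have hqab : q ∈ Icc (xA - yC) (xB - yA) := ⟨hrab.1.trans hrq, min_le_left _ _⟩
  have hφpl := h.monotone hpab hlab hpl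
  have hφrq := h.sub_le hrab hqab hrq
  -- The constant through the graph at `p`, the line of slope one through the graph at `q`, and the
  -- two lines through the graph at `l` and `r`.
  set c : (ℝ × ℝ) × (ℝ × ℝ) × (ℝ × ℝ) :=
    ((φ p, φ q - q), (s₁, φ l - s₁ * l), (s₂, φ r - s₂ * r)) with hc
  have hval : ∀ d, fourPiece c d = max (max (φ p) (φ l + s₁ * (d - l)))
      (max (φ r + s₂ * (d - r)) (φ q + (d - q))) := by
    intro d
    simp only [fourPiece, hc]
    ring_nf
  have hval_left : ∀ d ≤ l, fourPiece c d = max (φ p) (φ l + s₁ * (d - l)) := by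
    intro d hd
    rw [hval]
    refine max_eq_left (le_max_of_le_right (max_le ?_ ?_))
    · nlinarith
    · nlinarith [hs₂.2]
  have hval_mid : ∀ d, l ≤ d → d ≤ r →
      fourPiece c d = max (φ l + s₁ * (d - l)) (φ r + s₂ * (d - r)) := by
    intro d hd hd'
    rw [hval, max_eq_right (a := φ p), max_eq_left (b := φ q + (d - q))]
    · nlinarith [hs₂.2]
    · nlinarith [hs₁.1]
  have hval_right : ∀ d ≥ r, fourPiece c d = max (φ r + s₂ * (d - r)) (φ q + (d - q)) := by
    intro d hd
    rw [hval]
    refine max_eq_right (le_max_of_le_left (max_le ?_ ?_))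
    · nlinarith [hs₂.1, h.monotone hlab hrab hlr]
    · nlinarith
  refine ⟨c, ?_, fun d hd => ?_⟩
  -- Every coefficient is an intercept `φ e - s * d`, with both terms bounded by `xB + yC`; the
  -- factor 3 is generous.
  · have hsM : ∀ s ∈ Icc (0 : ℝ) 1, ∀ d ∈ Icc (xA - yC) (xB - yA), ∀ e ∈ Icc (xA - yC) (xB - yA),
        φ e - s * d ∈ Icc (-(3 * (xB + yC))) (3 * (xB + yC)) := by
      intro s hs d hd e he
      have h2 := abs_le.1 (hbound e he)
      have h3 : |s * d| ≤ xB + yC := by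
        rw [abs_mul, abs_of_nonneg hs.1]
        exact (mul_le_of_le_one_left (abs_nonneg _) hs.2).trans (hdbound d hd)
      have h4 := abs_le.1 h3
      constructor <;> linarith
    refine ⟨⟨?_, ?_⟩, ⟨hs₁, hsM _ hs₁ l hlab l hlab⟩, ⟨hs₂, hsM _ hs₂ r hrab r hrab⟩⟩
    · simpa using hsM 0 (by simp) p hpab p hpab
    · simpa only [one_mul] using hsM 1 (by simp) q hqab q hqab
  rcases le_total d l with hdl | hdl
  · have hφd := h.sub_le hd hlab hdl
    have hv := hval_left d hdl
    refine diagonalRevenue_le_of_entry_left hx ⟨hd.1, hdl.trans hl.2⟩ (by linarith) ?_ ?_ ?_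
    · have : φ l + s₁ * (d - l) ≤ fourPiece c d := hv ▸ le_max_right _ _
      nlinarith [hs₁.2]
    · intro h2 h3
      have hdp : d ≤ p := le_max_of_le_right (le_min hdl (le_min h2 h3))
      exact (h.monotone hd hpab hdp).trans (hv ▸ le_max_left _ _)
    · intro h2
      rw [hv]
      refine max_le (h.monotone hpab hd (max_le hd.1 ?_)) (hleft d ⟨hd.1, hdl⟩)
      refine (min_le_right _ _).trans (min_le_iff.2 (h2.imp le_of_lt le_of_lt))
  rcases le_total d r with hdr | hdr
  · have hv := hval_mid d hdl hdr
    have hexd := hexit d hd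
    have hφ₁ := h.sub_le hlab hd hdl
    have hφ₂ := h.monotone hd hrab hdr
    have hφ₃ := h.monotone hlab hd hdl
    have hφ₄ := h.sub_le hd hrab hdr
    refine diagonalRevenue_le_of_between ?_ ?_ hexd ?_ (hmid d ⟨hdl, hdr⟩ _ hv)
    · rcases le_total (xA - d) yA with hc | hc
      · rw [entryY, max_eq_left hc]; linarith
      · rw [entryY, max_eq_right hc]; linarith
    · rw [hv]
      have : max (φ l + s₁ * (d - l)) (φ r + s₂ * (d - r)) ≤ min (d - xA) (-yA) := by
        refine max_le (le_min ?_ ?_) (le_min ?_ ?_)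
        · nlinarith [hs₁.2]
        · nlinarith [hs₁.1]
        · nlinarith [hs₂.2]
        · nlinarith [hs₂.1]
      have h3 := le_min_iff.1 this
      rcases le_total (xA - d) yA with hc | hc
      · rw [entryY, max_eq_left hc]; linarith [h3.2]
      · rw [entryY, max_eq_right hc]; linarith [h3.1]
    · have h2 : φ l + s₁ * (d - l) ≤ fourPiece c d := hv ▸ le_max_left _ _
      have h3 : φ r + s₂ * (d - r) ≤ fourPiece c d := hv ▸ le_max_right _ _
      have h4 := hexit l hlab
      have h5 := hexit r hrab
      rcases le_total yC (xB - d) with hc | hc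
      · rw [exitY, min_eq_left hc]
        have : exitY xB yC l ≤ yC := min_le_left _ _
        nlinarith [hs₁.1]
      · rw [exitY, min_eq_right hc]
        have : exitY xB yC r ≤ xB - r := min_le_right _ _
        nlinarith [hs₂.2]
  · have hv := hval_right d hdr
    by_cases hdeq : d ≤ xA - yA
    -- This is the diagonal through the corner `(xA, yA)`, where the two functions agree.
    · obtain rfl : d = r := le_antisymm (hdeq.trans hr.1) hdr
      have : fourPiece c d = φ d := by
        rw [hv, sub_self, mul_zero, add_zero]
        exact max_eq_left (by linarith)
      rw [diagonalRevenue_saleUtility, diagonalRevenue_saleUtility, this]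
    have hφd := h.monotone hrab hd hdr
    refine diagonalRevenue_le_of_entry_bottom hy ⟨not_le.1 hdeq, hd.2⟩ (by linarith) ?_ ?_ ?_
    · have : φ r + s₂ * (d - r) ≤ fourPiece c d := hv ▸ le_max_left _ _
      nlinarith [hs₂.1]
    · intro h2 h3
      have hqd : q ≤ d := min_le_of_right_le (max_le hdr (max_le h2.le h3))
      have h4 : φ q + (d - q) ≤ fourPiece c d := hv ▸ le_max_right _ _
      linarith [h.sub_le hqab hd hqd]
    · intro h2
      rw [hv]
      refine max_le (hright d ⟨hdr, hd.2⟩) ?_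
      have hdq : d ≤ q := le_min hd.2 (le_max_of_le_right (le_max_iff.2 (h2.imp id le_of_lt)))
      linarith [h.sub_le hd hqab hdq]

end Reduction

/-! ### Revenue as a functional of the utility -/

section RevenueFormula

variable {xA xB yA yC : ℝ}

/-- The revenue of a mechanism with utility function `U`, up to the factor `1 / area`, after
integration by parts. -/
noncomputable def boundaryRevenue (xA xB yA yC : ℝ) (U : ℝ × ℝ → ℝ) : ℝ :=
  (xB * ∫ y in yA..yC, U (xB, y)) - (xA * ∫ y in yA..yC, U (xA, y))
    + (yC * ∫ x in xA..xB, U (x, yC)) - (yA * ∫ x in xA..xB, U (x, yA))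
    - 3 * ∫ v in typeSpace xA xB yA yC, U v

theorem typeLaw_eq (xA xB yA yC : ℝ) (hx : xA < xB) (hy : yA < yC) :
    typeLaw xA xB yA yC = ENNReal.ofReal ((xB - xA) * (yC - yA))⁻¹ •
      volume.restrict (typeSpace xA xB yA yC) := by
  rw [typeLaw, uniformLaw, uniformLaw, ProbabilityTheory.cond, ProbabilityTheory.cond,
    Measure.prod_smul_left, Measure.prod_smul_right, Measure.prod_restrict, smul_smul,
    Real.volume_Icc, Real.volume_Icc, mul_inv, ENNReal.ofReal_mul (by simpa using hx.le),
    ENNReal.ofReal_inv_of_pos (by linarith), ENNReal.ofReal_inv_of_pos (by linarith)]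
  rfl

theorem integral_id_mul_deriv_of_lipschitz {g : ℝ → ℝ} {K : NNReal} (hg : LipschitzWith K g)
    (a b : ℝ) : ∫ x in a..b, x * deriv g x = b * g b - a * g a - ∫ x in a..b, g x := by
  have h := AbsolutelyContinuousOnInterval.integral_mul_deriv_eq_deriv_mul (f := id) (g := g)
    (a := a) (b := b) (LipschitzWith.id.lipschitzOnWith.absolutelyContinuousOnInterval)
    hg.lipschitzOnWith.absolutelyContinuousOnInterval
  simpa using h

theorem setIntegral_typeSpace (hx : xA ≤ xB) (hy : yA ≤ yC) {f : ℝ × ℝ → ℝ}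
    (hf : IntegrableOn f (typeSpace xA xB yA yC)) :
    ∫ v in typeSpace xA xB yA yC, f v = ∫ x in xA..xB, ∫ y in yA..yC, f (x, y) := by
  simp only [intervalIntegral.integral_of_le hx, intervalIntegral.integral_of_le hy,
    ← integral_Icc_eq_integral_Ioc]
  exact setIntegral_prod f hf

theorem setIntegral_typeSpace_symm (hx : xA ≤ xB) (hy : yA ≤ yC) {f : ℝ × ℝ → ℝ}
    (hf : IntegrableOn f (typeSpace xA xB yA yC)) :
    ∫ v in typeSpace xA xB yA yC, f v = ∫ y in yA..yC, ∫ x in xA..xB, f (x, y) := by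
  simp only [intervalIntegral.integral_of_le hx, intervalIntegral.integral_of_le hy,
    ← integral_Icc_eq_integral_Ioc]
  have h : volume.restrict (typeSpace xA xB yA yC) =
      (volume.restrict (Icc xA xB)).prod (volume.restrict (Icc yA yC)) := by
    rw [Measure.prod_restrict]; rfl
  rw [IntegrableOn, h] at hf
  rw [h, integral_prod_symm f hf]

theorem lipschitzWith_slice_left {U : ℝ × ℝ → ℝ} (hU : LipschitzWith 1 U) (y : ℝ) :
    LipschitzWith 1 fun x => U (x, y) := by
  have := hU.comp (LipschitzWith.prodMk_right (α := ℝ) y)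
  rw [mul_one] at this
  exact this

theorem lipschitzWith_slice_right {U : ℝ × ℝ → ℝ} (hU : LipschitzWith 1 U) (x : ℝ) :
    LipschitzWith 1 fun y => U (x, y) := by
  have := hU.comp (LipschitzWith.prodMk_left (β := ℝ) x)
  rw [mul_one] at this
  exact this

theorem measurable_deriv_left {U : ℝ × ℝ → ℝ} (hU : Continuous U) :
    Measurable fun v : ℝ × ℝ => deriv (fun x => U (x, v.2)) v.1 :=
  (measurable_deriv_with_param (f := fun y x => U (x, y))
    (hU.comp continuous_swap)).comp measurable_swap

theorem measurable_deriv_right {U : ℝ × ℝ → ℝ} (hU : Continuous U) :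
    Measurable fun v : ℝ × ℝ => deriv (fun y => U (v.1, y)) v.2 :=
  measurable_deriv_with_param (f := fun x y => U (x, y)) hU

/-- The payment in terms of the utility, for a Lipschitz function in place of the latter. -/
theorem integral_payment_of_lipschitz (hx : xA ≤ xB) (hy : yA ≤ yC) {U : ℝ × ℝ → ℝ}
    (hU : LipschitzWith 1 U) :
    IntegrableOn (fun v : ℝ × ℝ => v.1 * deriv (fun x => U (x, v.2)) v.1 +
      v.2 * deriv (fun y => U (v.1, y)) v.2 - U v) (typeSpace xA xB yA yC) ∧
    ∫ v in typeSpace xA xB yA yC, (v.1 * deriv (fun x => U (x, v.2)) v.1 +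
      v.2 * deriv (fun y => U (v.1, y)) v.2 - U v) = boundaryRevenue xA xB yA yC U := by
  have hcomp : IsCompact (typeSpace xA xB yA yC) := isCompact_Icc.prod isCompact_Icc
  have hIU : IntegrableOn U (typeSpace xA xB yA yC) :=
    hU.continuous.continuousOn.integrableOn_compact hcomp
  have hI₁ : IntegrableOn (fun v : ℝ × ℝ => v.1 * deriv (fun x => U (x, v.2)) v.1)
      (typeSpace xA xB yA yC) :=
    Integrable.mul_bdd (c := 1) (continuous_fst.continuousOn.integrableOn_compact hcomp)
      (measurable_deriv_left hU.continuous).aestronglyMeasurable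
      (.of_forall fun v => by
        simpa using norm_deriv_le_of_lipschitz (lipschitzWith_slice_left hU v.2))
  have hI₂ : IntegrableOn (fun v : ℝ × ℝ => v.2 * deriv (fun y => U (v.1, y)) v.2)
      (typeSpace xA xB yA yC) :=
    Integrable.mul_bdd (c := 1) (continuous_snd.continuousOn.integrableOn_compact hcomp)
      (measurable_deriv_right hU.continuous).aestronglyMeasurable
      (.of_forall fun v => by
        simpa using norm_deriv_le_of_lipschitz (lipschitzWith_slice_right hU v.1))
  have hc := hU.continuous
  have hI : IntegrableOn (fun v : ℝ × ℝ => v.1 * deriv (fun x => U (x, v.2)) v.1 +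
      v.2 * deriv (fun y => U (v.1, y)) v.2) (typeSpace xA xB yA yC) := hI₁.add hI₂
  refine ⟨hI.sub hIU, ?_⟩
  rw [integral_sub hI hIU, integral_add hI₁ hI₂, setIntegral_typeSpace_symm hx hy hI₁,
    setIntegral_typeSpace hx hy hI₂, boundaryRevenue]
  simp only [integral_id_mul_deriv_of_lipschitz (lipschitzWith_slice_left hU _),
    integral_id_mul_deriv_of_lipschitz (lipschitzWith_slice_right hU _)]
  have h1 : ∫ y in yA..yC, (xB * U (xB, y) - xA * U (xA, y) - ∫ x in xA..xB, U (x, y)) =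
      (xB * ∫ y in yA..yC, U (xB, y)) - (xA * ∫ y in yA..yC, U (xA, y))
        - ∫ v in typeSpace xA xB yA yC, U v := by
    rw [intervalIntegral.integral_sub, intervalIntegral.integral_sub,
      intervalIntegral.integral_const_mul, intervalIntegral.integral_const_mul,
      setIntegral_typeSpace_symm hx hy hIU]
    all_goals exact Continuous.intervalIntegrable (by fun_prop) _ _
  have h2 : ∫ x in xA..xB, (yC * U (x, yC) - yA * U (x, yA) - ∫ y in yA..yC, U (x, y)) =
      (yC * ∫ x in xA..xB, U (x, yC)) - (yA * ∫ x in xA..xB, U (x, yA))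
        - ∫ v in typeSpace xA xB yA yC, U v := by
    rw [intervalIntegral.integral_sub, intervalIntegral.integral_sub,
      intervalIntegral.integral_const_mul, intervalIntegral.integral_const_mul,
      setIntegral_typeSpace hx hy hIU]
    all_goals exact Continuous.intervalIntegrable (by fun_prop) _ _
  rw [h1, h2]
  ring

namespace Mechanism

variable {m : Mechanism} {V : Set (ℝ × ℝ)}

theorem IsIC.subgradient (h : m.IsIC V) {v w : ℝ × ℝ} (hv : v ∈ V) (hw : w ∈ V) :
    m.utility v + m.q₁ v * (w.1 - v.1) + m.q₂ v * (w.2 - v.2) ≤ m.utility w := by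
  have := h w hw v hv
  have hu : m.utility v = v.1 * m.q₁ v + v.2 * m.q₂ v - m.t v := rfl
  rw [reportUtility] at this
  linarith

theorem IsFeasible.utility_sub_le (h : m.IsFeasible V) {v w : ℝ × ℝ} (hv : v ∈ V) (hw : w ∈ V) :
    m.utility v - m.utility w ≤ dist v w := by
  have h1 := h.ic.subgradient hv hw
  obtain ⟨h2, h3⟩ := h.allocation v hv
  have h4 := h.unitDemand v hv
  have h5 : v.1 - w.1 ≤ dist v w :=
    (le_abs_self _).trans ((Real.dist_eq _ _).symm.trans_le (le_max_left _ _))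
  have h6 : v.2 - w.2 ≤ dist v w :=
    (le_abs_self _).trans ((Real.dist_eq _ _).symm.trans_le (le_max_right _ _))
  have h7 := mul_le_mul_of_nonneg_left h5 h2.1
  have h8 := mul_le_mul_of_nonneg_left h6 h3.1
  have h9 : (m.q₁ v + m.q₂ v) * dist v w ≤ dist v w :=
    mul_le_of_le_one_left dist_nonneg h4
  linarith

/-- An extension to the whole plane makes Rademacher's theorem and integration by parts available.
The constant 1, for the sup distance, comes from `q₁ + q₂ ≤ 1`. -/
theorem IsFeasible.exists_lipschitz (h : m.IsFeasible V) :
    ∃ U : ℝ × ℝ → ℝ, LipschitzWith 1 U ∧ EqOn m.utility U V := by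
  refine LipschitzOnWith.extend_real (LipschitzOnWith.of_dist_le_mul fun v hv w hw => ?_)
  rw [NNReal.coe_one, one_mul, Real.dist_eq, abs_le]
  have h1 := h.utility_sub_le hv hw
  have h2 := h.utility_sub_le hw hv
  rw [dist_comm] at h2
  constructor <;> linarith

/-- At an interior point of differentiability the only subgradient is the gradient: `U` minus the
linear function given by the allocation has a local minimum in each coordinate. Hence the partial
derivatives are `q₁` and `q₂`. -/
theorem IsFeasible.ae_payment_eq (h : m.IsFeasible (typeSpace xA xB yA yC)) {U : ℝ × ℝ → ℝ}
    (hU : LipschitzWith 1 U) (hUm : EqOn m.utility U (typeSpace xA xB yA yC)) :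
    ∀ᵐ v ∂volume.restrict (typeSpace xA xB yA yC),
      v.1 * deriv (fun x => U (x, v.2)) v.1 + v.2 * deriv (fun y => U (v.1, y)) v.2 - U v
        = m.t v := by
  have hae : (Ioo xA xB ×ˢ Ioo yA yC : Set (ℝ × ℝ)) =ᵐ[volume] typeSpace xA xB yA yC :=
    Measure.set_prod_ae_eq Ioo_ae_eq_Icc Ioo_ae_eq_Icc
  rw [← Measure.restrict_congr_set hae,
    ae_restrict_iff' (measurableSet_Ioo.prod measurableSet_Ioo)]
  filter_upwards [hU.ae_differentiableAt (μ := volume)] with v hv hvV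
  obtain ⟨⟨hv1, hv2⟩, hv3, hv4⟩ := hvV
  have hvmem : v ∈ typeSpace xA xB yA yC := ⟨⟨hv1.le, hv2.le⟩, hv3.le, hv4.le⟩
  have hd₁ : DifferentiableAt ℝ (fun x => U (x, v.2)) v.1 :=
    DifferentiableAt.comp (g := U) (f := fun x => (x, v.2)) v.1 hv (by fun_prop)
  have hd₂ : DifferentiableAt ℝ (fun y => U (v.1, y)) v.2 :=
    DifferentiableAt.comp (g := U) (f := fun y => (v.1, y)) v.2 hv (by fun_prop)
  have hq₁ : deriv (fun x => U (x, v.2)) v.1 - m.q₁ v = 0 := by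
    refine IsLocalMin.hasDerivAt_eq_zero (f := fun x => U (x, v.2) - m.q₁ v * x) (a := v.1) ?_ ?_
    · filter_upwards [Icc_mem_nhds hv1 hv2] with x hx
      have hw : (x, v.2) ∈ typeSpace xA xB yA yC := ⟨hx, hv3.le, hv4.le⟩
      have := h.ic.subgradient hvmem hw
      rw [hUm hvmem, hUm hw] at this
      simp only [Prod.mk.eta]
      linarith
    · exact hd₁.hasDerivAt.sub (by simpa using (hasDerivAt_id v.1).const_mul (m.q₁ v))
  have hq₂ : deriv (fun y => U (v.1, y)) v.2 - m.q₂ v = 0 := by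
    refine IsLocalMin.hasDerivAt_eq_zero (f := fun y => U (v.1, y) - m.q₂ v * y) (a := v.2) ?_ ?_
    · filter_upwards [Icc_mem_nhds hv3 hv4] with y hy
      have hw : (v.1, y) ∈ typeSpace xA xB yA yC := ⟨⟨hv1.le, hv2.le⟩, hy⟩
      have := h.ic.subgradient hvmem hw
      rw [hUm hvmem, hUm hw] at this
      simp only [Prod.mk.eta]
      linarith
    · exact hd₂.hasDerivAt.sub (by simpa using (hasDerivAt_id v.2).const_mul (m.q₂ v))
  rw [sub_eq_zero.1 hq₁, sub_eq_zero.1 hq₂, ← hUm hvmem, utility, reportUtility]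
  ring

theorem IsFeasible.integrable_and_revenue_eq (hx : xA < xB) (hy : yA < yC)
    (h : m.IsFeasible (typeSpace xA xB yA yC)) {U : ℝ × ℝ → ℝ}
    (hU : LipschitzWith 1 U) (hUm : EqOn m.utility U (typeSpace xA xB yA yC)) :
    Integrable m.t (typeLaw xA xB yA yC) ∧ m.revenue (typeLaw xA xB yA yC) =
      ((xB - xA) * (yC - yA))⁻¹ * boundaryRevenue xA xB yA yC U := by
  have hae := h.ae_payment_eq hU hUm
  obtain ⟨h1, h2⟩ := integral_payment_of_lipschitz hx.le hy.le hU (xA := xA) (yA := yA)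
  have hpos : 0 ≤ ((xB - xA) * (yC - yA))⁻¹ :=
    inv_nonneg.2 (mul_nonneg (by linarith) (by linarith))
  rw [revenue, typeLaw_eq _ _ _ _ hx hy]
  refine ⟨Integrable.smul_measure (h1.congr hae) ENNReal.ofReal_ne_top, ?_⟩
  rw [integral_smul_measure, ENNReal.toReal_ofReal hpos, ← h2, integral_congr_ae hae, smul_eq_mul]

end Mechanism

end RevenueFormula

/-! ### Integration along the diagonals -/

section DiagonalFormula

variable {xA xB yA yC : ℝ}

theorem integral_ite_le {f g : ℝ → ℝ} (hf : Continuous f) (hg : Continuous g) {a b c : ℝ}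
    (hac : a ≤ c) (hcb : c ≤ b) :
    IntervalIntegrable (fun d => if d ≤ c then f d else g d) volume a b ∧
      ∫ d in a..b, (if d ≤ c then f d else g d) = (∫ d in a..c, f d) + ∫ d in c..b, g d := by
  have h1 : EqOn f (fun d => if d ≤ c then f d else g d) (uIoc a c) := fun d hd => by
    rw [uIoc_of_le hac] at hd
    exact (if_pos hd.2).symm
  have h2 : EqOn g (fun d => if d ≤ c then f d else g d) (uIoc c b) := fun d hd => by
    rw [uIoc_of_le hcb] at hd
    exact (if_neg (not_le.2 hd.1)).symm
  have h3 := (hf.intervalIntegrable (μ := volume) a c).congr h1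
  have h4 := (hg.intervalIntegrable (μ := volume) c b).congr h2
  refine ⟨h3.trans h4, ?_⟩
  rw [← intervalIntegral.integral_add_adjacent_intervals h3 h4,
    intervalIntegral.integral_congr_ae (.of_forall h1),
    intervalIntegral.integral_congr_ae (.of_forall h2)]

theorem integral_exit {U : ℝ × ℝ → ℝ} (hU : Continuous U) (hx : xA < xB) (hy : yA < yC) :
    IntervalIntegrable (fun d => (if d ≤ xB - yC then yC else xB) *
      U (d + exitY xB yC d, exitY xB yC d)) volume (xA - yC) (xB - yA) ∧
    ∫ d in (xA - yC)..(xB - yA), (if d ≤ xB - yC then yC else xB) *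
      U (d + exitY xB yC d, exitY xB yC d) =
      (yC * ∫ x in xA..xB, U (x, yC)) + xB * ∫ y in yA..yC, U (xB, y) := by
  have h : (fun d => (if d ≤ xB - yC then yC else xB) * U (d + exitY xB yC d, exitY xB yC d)) =
      fun d => if d ≤ xB - yC then yC * U (d + yC, yC) else xB * U (xB, xB - d) := by
    funext d
    split_ifs with hd
    · rw [exitY, min_eq_left (by linarith)]
    · rw [exitY, min_eq_right (by linarith), add_sub_cancel]
  rw [h]
  have h2 := integral_ite_le (f := fun d => yC * U (d + yC, yC))
    (g := fun d => xB * U (xB, xB - d)) (by fun_prop) (by fun_prop)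
    (a := xA - yC) (b := xB - yA) (c := xB - yC) (by linarith) (by linarith)
  refine ⟨h2.1, h2.2.trans ?_⟩
  rw [intervalIntegral.integral_const_mul, intervalIntegral.integral_const_mul,
    intervalIntegral.integral_comp_add_right (fun x => U (x, yC)),
    intervalIntegral.integral_comp_sub_left (fun y => U (xB, y))]
  simp only [sub_add_cancel, sub_sub_cancel]

theorem integral_entry {U : ℝ × ℝ → ℝ} (hU : Continuous U) (hx : xA < xB) (hy : yA < yC) :
    IntervalIntegrable (fun d => (if d ≤ xA - yA then xA else yA) *
      U (d + entryY xA yA d, entryY xA yA d)) volume (xA - yC) (xB - yA) ∧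
    ∫ d in (xA - yC)..(xB - yA), (if d ≤ xA - yA then xA else yA) *
      U (d + entryY xA yA d, entryY xA yA d) =
      (xA * ∫ y in yA..yC, U (xA, y)) + yA * ∫ x in xA..xB, U (x, yA) := by
  have h : (fun d => (if d ≤ xA - yA then xA else yA) * U (d + entryY xA yA d, entryY xA yA d)) =
      fun d => if d ≤ xA - yA then xA * U (xA, xA - d) else yA * U (d + yA, yA) := by
    funext d
    split_ifs with hd
    · rw [entryY, max_eq_right (by linarith), add_sub_cancel]
    · rw [entryY, max_eq_left (by linarith)]
  rw [h]
  have h2 := integral_ite_le (f := fun d => xA * U (xA, xA - d))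
    (g := fun d => yA * U (d + yA, yA)) (by fun_prop) (by fun_prop)
    (a := xA - yC) (b := xB - yA) (c := xA - yA) (by linarith) (by linarith)
  refine ⟨h2.1, h2.2.trans ?_⟩
  rw [intervalIntegral.integral_const_mul, intervalIntegral.integral_const_mul,
    intervalIntegral.integral_comp_add_right (fun x => U (x, yA)),
    intervalIntegral.integral_comp_sub_left (fun y => U (xA, y))]
  simp only [sub_add_cancel, sub_sub_cancel]

theorem mem_typeSpace_diagonal {d y : ℝ} :
    (d + y, y) ∈ typeSpace xA xB yA yC ↔ y ∈ Icc (entryY xA yA d) (exitY xB yC d) := by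
  simp only [typeSpace, mem_prod, mem_Icc, entryY, exitY, max_le_iff, le_min_iff]
  constructor
  · rintro ⟨⟨h1, h2⟩, h3, h4⟩
    refine ⟨⟨h3, ?_⟩, h4, ?_⟩ <;> linarith
  · rintro ⟨⟨h1, h2⟩, h3, h4⟩
    refine ⟨⟨?_, ?_⟩, h1, h3⟩ <;> linarith

/-- Integration over the rectangle along its diagonals. -/
theorem integral_diagonals {U : ℝ × ℝ → ℝ} (hU : Continuous U) (hx : xA < xB) (hy : yA < yC) :
    IntervalIntegrable (fun d => ∫ y in entryY xA yA d..exitY xB yC d, U (d + y, y)) volume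
      (xA - yC) (xB - yA) ∧
    ∫ d in (xA - yC)..(xB - yA), ∫ y in entryY xA yA d..exitY xB yC d, U (d + y, y) =
      ∫ v in typeSpace xA xB yA yC, U v := by
  have hcomp : IsCompact (typeSpace xA xB yA yC) := isCompact_Icc.prod isCompact_Icc
  have hab : xA - yC ≤ xB - yA := by linarith
  set g := (typeSpace xA xB yA yC).indicator U with hg
  have hgi : Integrable g volume :=
    (hU.continuousOn.integrableOn_compact hcomp).integrable_indicator hcomp.measurableSet
  -- The shear to the coordinates `(d, y)` preserves area, so Fubini applies to the diagonals
  -- without a Jacobian.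
  have hmp : MeasurePreserving (fun z : ℝ × ℝ => (z.1 + z.2, z.2)) volume volume :=
    measurePreserving_add_prod volume volume
  have hemb : MeasurableEmbedding (fun z : ℝ × ℝ => (z.1 + z.2, z.2)) :=
    (Homeomorph.mk (Equiv.mk (fun z : ℝ × ℝ => (z.1 + z.2, z.2)) (fun z => (z.1 - z.2, z.2))
      (fun z => by simp) (fun z => by simp)) (by fun_prop) (by fun_prop)).measurableEmbedding
  have hshear : Integrable (fun z : ℝ × ℝ => g (z.1 + z.2, z.2)) (volume.prod volume) :=
    (hmp.integrable_comp_emb hemb).2 hgi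
  have hinner : ∀ d ∈ Icc (xA - yC) (xB - yA), ∫ y, g (d + y, y) =
      ∫ y in entryY xA yA d..exitY xB yC d, U (d + y, y) := by
    intro d hd
    rw [intervalIntegral.integral_of_le (entryY_le_exitY hx hy hd),
      ← integral_Icc_eq_integral_Ioc, ← integral_indicator measurableSet_Icc]
    congr 1 with y
    simp only [hg, indicator, mem_typeSpace_diagonal]
  have hzero : ∀ d ∉ Icc (xA - yC) (xB - yA), ∫ y, g (d + y, y) = 0 := by
    intro d hd
    refine integral_eq_zero_of_ae (.of_forall fun y => ?_)
    refine indicator_of_notMem (fun h => hd ?_) _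
    obtain ⟨⟨h1, h2⟩, h3, h4⟩ := h
    dsimp only at h1 h2 h3 h4
    exact ⟨by linarith, by linarith⟩
  have hint : IntegrableOn (fun d => ∫ y in entryY xA yA d..exitY xB yC d, U (d + y, y))
      (Icc (xA - yC) (xB - yA)) :=
    hshear.integral_prod_left.integrableOn.congr_fun hinner measurableSet_Icc
  refine ⟨(intervalIntegrable_iff_integrableOn_Icc_of_le hab).2 hint, ?_⟩
  rw [intervalIntegral.integral_of_le hab, ← integral_Icc_eq_integral_Ioc,
    ← setIntegral_congr_fun measurableSet_Icc hinner,
    setIntegral_eq_integral_of_forall_compl_eq_zero hzero, ← integral_indicator hcomp.measurableSet,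
    ← hmp.integral_comp hemb]
  exact (integral_prod _ hshear).symm

theorem integral_diagonalRevenue {U : ℝ × ℝ → ℝ} (hU : Continuous U) (hx : xA < xB)
    (hy : yA < yC) :
    IntervalIntegrable (diagonalRevenue xA xB yA yC U) volume (xA - yC) (xB - yA) ∧
    ∫ d in (xA - yC)..(xB - yA), diagonalRevenue xA xB yA yC U d =
      boundaryRevenue xA xB yA yC U := by
  obtain ⟨h1, h1'⟩ := integral_exit hU hx hy
  obtain ⟨h2, h2'⟩ := integral_entry hU hx hy
  obtain ⟨h3, h3'⟩ := integral_diagonals hU hx hy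
  refine ⟨(h1.sub h2).sub (h3.const_mul 3), ?_⟩
  simp only [diagonalRevenue]
  rw [intervalIntegral.integral_sub (h1.sub h2) (h3.const_mul 3),
    intervalIntegral.integral_sub h1 h2, intervalIntegral.integral_const_mul, h1', h2', h3',
    boundaryRevenue]
  ring

end DiagonalFormula

/-! ### From arbitrary mechanisms to four-piece functions -/

section Improvement

variable {xA xB yA yC : ℝ}

/-- The function `φ` for which the sale utility of `φ` agrees with the utility function of `m` at
the ends of the diagonals. -/
noncomputable def exitProfile (xB yC : ℝ) (m : Mechanism) (d : ℝ) : ℝ :=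
  m.utility (d + exitY xB yC d, exitY xB yC d) - exitY xB yC d

theorem exit_mem_typeSpace (hx : xA < xB) (hy : yA < yC) {d : ℝ}
    (hd : d ∈ Icc (xA - yC) (xB - yA)) :
    (d + exitY xB yC d, exitY xB yC d) ∈ typeSpace xA xB yA yC :=
  mem_typeSpace_diagonal.2 ⟨entryY_le_exitY hx hy hd, le_rfl⟩

namespace Mechanism.IsFeasible

variable {m : Mechanism}

/-- Where diagonals exit through the top edge, the slope is `q₁`; on the right edge it is `1 - q₂`.
Across the corner the error term is `q₁ + q₂ - 1` times a nonpositive displacement, hence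
nonnegative by unit demand. -/
theorem hasUnitSubgradients_exitProfile (hx : xA < xB) (hy : yA < yC)
    (h : m.IsFeasible (typeSpace xA xB yA yC)) :
    HasUnitSubgradients (exitProfile xB yC m) (xA - yC) (xB - yA) := by
  intro d hd
  have hv := exit_mem_typeSpace hx hy hd
  have hsub := fun e he => h.ic.subgradient hv (exit_mem_typeSpace hx hy (d := e) he)
  obtain ⟨h1, h2⟩ := h.allocation _ hv
  have h3 := h.unitDemand _ hv
  simp only [exitProfile]
  set v := (d + exitY xB yC d, exitY xB yC d)
  by_cases hd0 : d ≤ xB - yC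
  · refine ⟨m.q₁ v, h1, fun e he => ?_⟩
    have h4 := hsub e he
    have h5 : exitY xB yC e ≤ exitY xB yC d := by
      rw [exitY, exitY, min_eq_left (b := xB - d) (by linarith)]
      exact min_le_left _ _
    have h6 : v.1 = d + exitY xB yC d := rfl
    have h7 : v.2 = exitY xB yC d := rfl
    rw [h6, h7] at h4
    nlinarith
  · refine ⟨1 - m.q₂ v, ⟨by linarith [h2.2], by linarith [h2.1]⟩, fun e he => ?_⟩
    have h4 := hsub e he
    have h5 : exitY xB yC e + e ≤ exitY xB yC d + d := by
      rw [exitY, exitY, min_eq_right (a := yC) (b := xB - d) (by linarith)]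
      linarith [min_le_right yC (xB - e)]
    have h6 : v.1 = d + exitY xB yC d := rfl
    have h7 : v.2 = exitY xB yC d := rfl
    rw [h6, h7] at h4
    nlinarith

/-- Utility grows at rate at most one along the diagonals. -/
theorem le_utility_diagonal (hx : xA < xB) (hy : yA < yC)
    (h : m.IsFeasible (typeSpace xA xB yA yC)) {d y : ℝ} (hd : d ∈ Icc (xA - yC) (xB - yA))
    (hyd : y ∈ Icc (entryY xA yA d) (exitY xB yC d)) :
    max 0 (y + exitProfile xB yC m d) ≤ m.utility (d + y, y) := by
  have hv := exit_mem_typeSpace hx hy hd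
  have hw := mem_typeSpace_diagonal.2 hyd
  refine max_le (h.ir _ hw) ?_
  have h1 := h.ic.subgradient hv hw
  have h2 := h.unitDemand _ hv
  dsimp only at h1
  rw [exitProfile]
  nlinarith [hyd.2]

/-- The sale utility agrees with the utility at the exit and is at most the utility elsewhere on the
diagonal, where utility enters with coefficients `-xA`, `-yA` and `-3`, none positive. -/
theorem diagonalRevenue_le (hxA : 0 ≤ xA) (hx : xA < xB) (hyA : 0 ≤ yA) (hy : yA < yC)
    (h : m.IsFeasible (typeSpace xA xB yA yC)) {U : ℝ × ℝ → ℝ} (hU : Continuous U)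
    (hUm : EqOn m.utility U (typeSpace xA xB yA yC)) {d : ℝ} (hd : d ∈ Icc (xA - yC) (xB - yA)) :
    diagonalRevenue xA xB yA yC U d ≤
      diagonalRevenue xA xB yA yC (saleUtility (exitProfile xB yC m)) d := by
  have hle := entryY_le_exitY hx hy hd
  have hv := exit_mem_typeSpace hx hy hd
  have hlow : ∀ y ∈ Icc (entryY xA yA d) (exitY xB yC d),
      max 0 (y + exitProfile xB yC m d) ≤ U (d + y, y) := fun y hyd =>
    (h.le_utility_diagonal hx hy hd hyd).trans_eq (hUm (mem_typeSpace_diagonal.2 hyd))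
  have hexit : U (d + exitY xB yC d, exitY xB yC d) =
      max 0 (exitY xB yC d + exitProfile xB yC m d) := by
    rw [exitProfile, add_sub_cancel, max_eq_right (h.ir _ hv), hUm hv]
  rw [diagonalRevenue_saleUtility, diagonalRevenue, hexit]
  have h1 := hlow _ ⟨le_rfl, hle⟩
  have h2 : 0 ≤ if d ≤ xA - yA then xA else yA := by split_ifs <;> assumption
  have h3 := mul_le_mul_of_nonneg_left h1 h2
  have h4 : ∫ y in entryY xA yA d..exitY xB yC d, max 0 (y + exitProfile xB yC m d) ≤
      ∫ y in entryY xA yA d..exitY xB yC d, U (d + y, y) :=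
    intervalIntegral.integral_mono_on hle
      (Continuous.intervalIntegrable (by fun_prop) _ _)
      (Continuous.intervalIntegrable (by fun_prop) _ _) hlow
  linarith

end Mechanism.IsFeasible

theorem continuous_saleUtility_fourPiece :
    Continuous fun p : ((ℝ × ℝ) × (ℝ × ℝ) × (ℝ × ℝ)) × (ℝ × ℝ) =>
      saleUtility (fourPiece p.1) p.2 := by
  unfold saleUtility fourPiece
  fun_prop

theorem continuous_boundaryRevenue_fourPiece :
    Continuous fun c => boundaryRevenue xA xB yA yC (saleUtility (fourPiece c)) := by
  have h := continuous_saleUtility_fourPiece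
  have h5 : Continuous fun c => ∫ v in typeSpace xA xB yA yC, saleUtility (fourPiece c) v :=
    continuous_parametric_integral_of_continuous h (isCompact_Icc.prod isCompact_Icc)
  have h1 : ∀ x, Continuous fun c => ∫ y in yA..yC, saleUtility (fourPiece c) (x, y) := fun x =>
    intervalIntegral.continuous_parametric_intervalIntegral_of_continuous'
      (f := fun c y => saleUtility (fourPiece c) (x, y))
      (h.comp (f := fun (p : ((ℝ × ℝ) × (ℝ × ℝ) × (ℝ × ℝ)) × ℝ) =>
        (p.1, x, p.2)) (by fun_prop)) _ _
  have h2 : ∀ y, Continuous fun c => ∫ x in xA..xB, saleUtility (fourPiece c) (x, y) := fun y =>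
    intervalIntegral.continuous_parametric_intervalIntegral_of_continuous'
      (f := fun c x => saleUtility (fourPiece c) (x, y))
      (h.comp (f := fun (p : ((ℝ × ℝ) × (ℝ × ℝ) × (ℝ × ℝ)) × ℝ) =>
        (p.1, p.2, y)) (by fun_prop)) _ _
  exact (((((h1 xB).const_mul xB).sub ((h1 xA).const_mul xA)).add ((h2 yC).const_mul yC)).sub
    ((h2 yA).const_mul yA)).sub (h5.const_mul 3)

/-- Raising all payments by the utility of the lowest type. -/
theorem Mechanism.IsFeasible.exists_binding (hx : xA < xB) (hy : yA < yC) {m : Mechanism}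
    (h : m.IsFeasible (typeSpace xA xB yA yC)) :
    ∃ m' : Mechanism, m'.IsFeasible (typeSpace xA xB yA yC) ∧ m'.utility (xA, yA) = 0 ∧
      m.revenue (typeLaw xA xB yA yC) ≤ m'.revenue (typeLaw xA xB yA yC) := by
  have hlow : (xA, yA) ∈ typeSpace xA xB yA yC := ⟨⟨le_rfl, hx.le⟩, le_rfl, hy.le⟩
  set δ := m.utility (xA, yA) with hδ
  set m' : Mechanism := ⟨m.q₁, m.q₂, fun v => m.t v + δ⟩ with hm'
  have hrep : ∀ v w, m'.reportUtility v w = m.reportUtility v w - δ := fun v w => by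
    simp only [Mechanism.reportUtility, hm']
    ring
  have hut : ∀ v, m'.utility v = m.utility v - δ := fun v => hrep v v
  have hfeas : m'.IsFeasible (typeSpace xA xB yA yC) := by
    refine ⟨h.allocation, h.unitDemand, fun v hv => ?_, fun v hv w hw => ?_⟩
    · have h1 := h.ic.subgradient hlow hv
      obtain ⟨h2, h3⟩ := h.allocation _ hlow
      have h4 := mul_nonneg h2.1 (sub_nonneg.2 hv.1.1)
      have h5 := mul_nonneg h3.1 (sub_nonneg.2 hv.2.1)
      rw [hut]
      dsimp only at h1
      linarith
    · rw [hrep, hut]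
      linarith [h.ic v hv w hw]
  refine ⟨m', hfeas, by rw [hut, sub_self], ?_⟩
  obtain ⟨U, hU, hUm⟩ := h.exists_lipschitz
  obtain ⟨U', hU', hUm'⟩ := hfeas.exists_lipschitz
  refine integral_mono (h.integrable_and_revenue_eq hx hy hU hUm).1
    (hfeas.integrable_and_revenue_eq hx hy hU' hUm').1 fun v => ?_
  exact le_add_of_nonneg_right (h.ir _ hlow)

/-- Four-piece functions do at least as well as arbitrary mechanisms. -/
theorem Mechanism.IsFeasible.exists_fourPiece_revenue_ge (hxA : 0 ≤ xA) (hx : xA < xB)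
    (hyA : 0 ≤ yA) (hy : yA < yC) {m : Mechanism} (h : m.IsFeasible (typeSpace xA xB yA yC)) :
    ∃ c ∈ fourPieceBox (3 * (xB + yC)), m.revenue (typeLaw xA xB yA yC) ≤
      ((xB - xA) * (yC - yA))⁻¹ *
        boundaryRevenue xA xB yA yC (saleUtility (fourPiece c)) := by
  obtain ⟨m', hm', hlow, hrev⟩ := h.exists_binding hx hy
  obtain ⟨U, hU, hUm⟩ := hm'.exists_lipschitz
  have hd1 : xA - yA ∈ Icc (xA - yC) (xB - yA) := ⟨by linarith, by linarith⟩
  have hentry : entryY xA yA (xA - yA) = yA := by rw [entryY, sub_sub_cancel, max_self]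
  obtain ⟨c, hc, hle⟩ := exists_fourPiece_ge hxA hx hyA hy
    (hm'.hasUnitSubgradients_exitProfile hx hy)
    (fun d hd => by
      rw [exitProfile, add_sub_cancel]
      exact hm'.ir _ (exit_mem_typeSpace hx hy hd))
    (by
      have := hm'.le_utility_diagonal hx hy hd1 ⟨le_rfl, entryY_le_exitY hx hy hd1⟩
      rw [hentry, sub_add_cancel, hlow] at this
      exact (le_max_right _ _).trans this)
  refine ⟨c, hc, hrev.trans ?_⟩
  rw [(hm'.integrable_and_revenue_eq hx hy hU hUm).2]
  have hcont : Continuous (saleUtility (fourPiece c)) :=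
    continuous_saleUtility_fourPiece.comp (f := fun v => (c, v)) (by fun_prop)
  obtain ⟨h1, h1'⟩ := integral_diagonalRevenue hU.continuous hx hy
  obtain ⟨h2, h2'⟩ := integral_diagonalRevenue hcont hx hy
  refine mul_le_mul_of_nonneg_left ?_ (inv_nonneg.2 (mul_nonneg (by linarith) (by linarith)))
  rw [← h1', ← h2']
  exact intervalIntegral.integral_mono_on (by linarith) h1 h2 fun d hd =>
    (hm'.diagonalRevenue_le hxA hx hyA hy hU.continuous hUm hd).trans (hle d hd)

end Improvement

/-! ### Mechanisms from menus -/

section Menu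

theorem Mechanism.IsFeasible.mono {m : Mechanism} {V W : Set (ℝ × ℝ)} (h : m.IsFeasible W)
    (hVW : V ⊆ W) : m.IsFeasible V :=
  ⟨fun v hv => h.allocation v (hVW hv), fun v hv => h.unitDemand v (hVW hv),
    fun v hv => h.ir v (hVW hv), fun v hv w hw => h.ic v (hVW hv) w (hVW hw)⟩

/-- The items of the menu that belongs to a four-piece function. -/
noncomputable def fourPieceItem (c : (ℝ × ℝ) × (ℝ × ℝ) × (ℝ × ℝ)) : Fin 5 → ℝ × ℝ × ℝ :=
  ![(0, 0, 0), (0, 1, -c.1.1), (c.2.1.1, 1 - c.2.1.1, -c.2.1.2),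
    (c.2.2.1, 1 - c.2.2.1, -c.2.2.2), (1, 0, -c.1.2)]

/-- Letting every type choose a favourite item from the menu of a four-piece function is feasible
and yields the sale utility of this function. -/
theorem exists_mechanism_fourPiece (c : (ℝ × ℝ) × (ℝ × ℝ) × (ℝ × ℝ))
    (h₁ : c.2.1.1 ∈ Icc (0 : ℝ) 1) (h₂ : c.2.2.1 ∈ Icc (0 : ℝ) 1) :
    ∃ m : Mechanism, m.IsFeasible univ ∧ m.utility = saleUtility (fourPiece c) ∧
      ∀ v, (m.q₁ v, m.q₂ v, m.t v) ∈ range (fourPieceItem c) := by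
  let val (i : Fin 5) (v : ℝ × ℝ) : ℝ :=
    v.1 * (fourPieceItem c i).1 + v.2 * (fourPieceItem c i).2.1 - (fourPieceItem c i).2.2
  have hval : ∀ v i, val i v ≤ saleUtility (fourPiece c) v ∧
      ∃ j, saleUtility (fourPiece c) v = val j v := by
    intro v i
    have h0 : val 0 v = 0 := by simp [val, fourPieceItem]
    have h1 : val 1 v = v.2 + c.1.1 := by simp [val, fourPieceItem]
    have h2 : val 2 v = v.2 + (c.2.1.1 * (v.1 - v.2) + c.2.1.2) := by
      simp [val, fourPieceItem]; ring
    have h3 : val 3 v = v.2 + (c.2.2.1 * (v.1 - v.2) + c.2.2.2) := by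
      simp [val, fourPieceItem]; ring
    have h4 : val 4 v = v.2 + (v.1 - v.2 + c.1.2) := by
      simp [val, fourPieceItem]; ring
    have hs : saleUtility (fourPiece c) v =
        max (val 0 v) (max (max (val 1 v) (val 2 v)) (max (val 3 v) (val 4 v))) := by
      rw [h0, h1, h2, h3, h4, max_add_add_left, max_add_add_left, max_add_add_left]
      rfl
    rw [hs]
    refine ⟨by fin_cases i <;> simp, ?_⟩
    rcases max_choice (val 0 v) (max (max (val 1 v) (val 2 v)) (max (val 3 v) (val 4 v)))
      with h | h <;> rw [h]
    · exact ⟨0, rfl⟩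
    rcases max_choice (max (val 1 v) (val 2 v)) (max (val 3 v) (val 4 v)) with h | h <;> rw [h]
    · rcases max_choice (val 1 v) (val 2 v) with h | h <;> exact ⟨_, h⟩
    · rcases max_choice (val 3 v) (val 4 v) with h | h <;> exact ⟨_, h⟩
  choose best hbest using fun v => (hval v 0).2
  let m : Mechanism := ⟨fun v => (fourPieceItem c (best v)).1,
    fun v => (fourPieceItem c (best v)).2.1, fun v => (fourPieceItem c (best v)).2.2⟩
  have hut : ∀ v, m.utility v = saleUtility (fourPiece c) v := fun v => (hbest v).symm
  have hitem : ∀ i, (fourPieceItem c i).1 ∈ Icc (0 : ℝ) 1 ∧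
      (fourPieceItem c i).2.1 ∈ Icc (0 : ℝ) 1 ∧
      (fourPieceItem c i).1 + (fourPieceItem c i).2.1 ≤ 1 := by
    obtain ⟨h1, h1'⟩ := h₁
    obtain ⟨h2, h2'⟩ := h₂
    intro i
    fin_cases i <;> simp [fourPieceItem, *]
  refine ⟨m, ⟨fun v _ => ⟨(hitem _).1, (hitem _).2.1⟩, fun v _ => (hitem _).2.2, fun v _ => ?_,
    fun v _ w _ => ?_⟩, funext hut, fun v => ⟨best v, rfl⟩⟩
  · rw [hut]
    exact le_max_left _ _
  · rw [hut]
    exact (hval v (best w)).1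

end Menu

/-! ### Existence of an optimum by compactness -/

theorem mainTheorem8 (xA xB yA yC : ℝ) (hxA : 0 ≤ xA) (hx : xA < xB) (hyA : 0 ≤ yA)
    (hy : yA < yC) :
    ∃ m : Mechanism,
      m.IsOptimal (typeSpace xA xB yA yC) (typeLaw xA xB yA yC) ∧
      ∃ α ∈ Set.Icc (0 : ℝ) 1, ∃ β ∈ Set.Icc (0 : ℝ) 1, ∃ t₁ t₂ tα tβ : ℝ,
        m.menu (typeSpace xA xB yA yC) ⊆
          {(0, 0, 0), (1, 0, t₁), (1 - α, α, tα), (0, 1, t₂), (β, 1 - β, tβ)} := by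
  have hbox : IsCompact (fourPieceBox (3 * (xB + yC))) :=
    (isCompact_Icc.prod isCompact_Icc).prod
      ((isCompact_Icc.prod isCompact_Icc).prod (isCompact_Icc.prod isCompact_Icc))
  have hne : (fourPieceBox (3 * (xB + yC))).Nonempty :=
    ⟨((0, 0), (0, 0), (0, 0)), by
      have : 0 ≤ xB + yC := by linarith
      simp [fourPieceBox, this]⟩
  obtain ⟨c, hc, hmax⟩ := hbox.exists_isMaxOn hne
    (continuous_boundaryRevenue_fourPiece (xA := xA) (xB := xB) (yA := yA) (yC := yC)).continuousOn
  have hs₁ : c.2.1.1 ∈ Icc (0 : ℝ) 1 := hc.2.1.1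
  have hs₂ : c.2.2.1 ∈ Icc (0 : ℝ) 1 := hc.2.2.1
  obtain ⟨m, hm, hut, hitems⟩ := exists_mechanism_fourPiece c hs₁ hs₂
  have hfeas := hm.mono (subset_univ (typeSpace xA xB yA yC))
  -- As `m` is feasible on the whole plane, its Lipschitz extension is the sale utility itself.
  obtain ⟨U, hU, hUm⟩ := hm.exists_lipschitz
  obtain ⟨hint, hrev⟩ := hfeas.integrable_and_revenue_eq hx hy hU (hUm.mono (subset_univ _))
  obtain rfl : saleUtility (fourPiece c) = U := by
    rw [← hut]
    exact funext fun v => hUm (mem_univ v)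
  refine ⟨m, ⟨hfeas, hint, fun m' hm' => ?_⟩, 1 - c.2.1.1, ⟨by linarith [hs₁.2], by linarith [hs₁.1]⟩,
    c.2.2.1, hs₂, -c.1.2, -c.1.1, -c.2.1.2, -c.2.2.2, ?_⟩
  · obtain ⟨c', hc', hle⟩ := hm'.exists_fourPiece_revenue_ge hxA hx hyA hy
    rw [hrev]
    exact hle.trans (mul_le_mul_of_nonneg_left (hmax hc')
      (inv_nonneg.2 (mul_nonneg (by linarith) (by linarith))))
  · rintro _ ⟨v, -, rfl⟩
    obtain ⟨i, hi⟩ := hitems v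
    dsimp only
    rw [← hi]
    fin_cases i <;> simp [fourPieceItem]
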